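/- For a complex number $s$ put $$\beta(s)=\sum_{k=0}^{\infty}\frac{(-1)^{k}}{(2k+1)^{s}},\qquad \beta_{H}(s)=\sum_{k=1}^{\infty}\frac{(-1)^{k-1}H_{k-1}}{(2k-1)^{s}},$$ whenever these series converge, where $H_m=1+\tfrac12+\dots+\tfrac1m$ is the $m$-th harmonic number ($H_0=0$) and infinite sums are limits of partial sums in the order of increasing $k$. Let $\zeta$ be the Riemann zeta function. Then the series $\beta(m)$ converges for every integer $m\ge 1$, and for every integer $n\ge 1$ the series $\beta_H(2n+1)$ converges and $$\beta_{H}(2n+1)=(2n+1)\,\beta(2n+2)-\beta(2n+1)\log 4-2\sum_{j=0}^{n-1}\Bigl(1-\frac{1}{2^{2n-2j+1}}\Bigr)\beta(2j+1)\,\zeta(2n-2j+1).$$ -/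

import Mathlib

/-- The `k`-th term, `k ≥ 0`, of the Dirichlet beta series: `(-1)^k / (2k+1)^s`. -/
noncomputable def betaTerm (s : ℂ) (k : ℕ) : ℂ :=
  (-1) ^ k / (2 * (k : ℂ) + 1) ^ s

/-- The Dirichlet beta function `β(s) = ∑_{k ≥ 0} (-1)^k / (2k+1)^s`. The sum is the limit of the
partial sums in the natural order of `k`; the series for `β(1)` converges only in that sense. -/
noncomputable def dirichletBeta (s : ℂ) : ℂ :=
  ∑'[SummationFilter.conditional ℕ] k, betaTerm s k

/-- The terms of `∑_{k ≥ 1} (-1)^{k-1} H_{k-1} / (2k-1)^s`, with `k = i + 1` and `i ≥ 0`: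
`(-1)^i H_i / (2i+1)^s`. -/
noncomputable def betaHTerm (s : ℂ) (i : ℕ) : ℂ :=
  (-1) ^ i * ((harmonic i : ℚ) : ℂ) / (2 * (i : ℂ) + 1) ^ s

/-- The Euler sum `β_H(s) = ∑_{k ≥ 1} (-1)^{k-1} H_{k-1} / (2k-1)^s`, again as a limit of
partial sums. -/
noncomputable def dirichletBetaH (s : ℂ) : ℂ :=
  ∑'[SummationFilter.conditional ℕ] i, betaHTerm s i

open Filter Topology

/-! Write `a = 2k+1`, `b = 2m+1` and sum `(-1)^k * eulerKernel n k m` in both orders; off the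
diagonal the kernel is `(-2/b + 1/(b-a) + 1/(b+a)) / a^(2n+1)`. Over `m` first, telescoping gives
`-(H_k + log 4) / a^(2n+1)` up to sign (`hasSum_eulerKernel_right`), hence `-β_H(2n+1) - β(2n+1) log
4`. Over `k` first, a finite geometric sum rewrites the kernel as products of odd powers of `1/a`
and `1/b`, a remainder whose alternating sum vanishes, and a diagonal correction
(`hasSum_eulerKernel_left`); this gives the products of beta and zeta values and `-(2n+1) β(2n+2)`.
Absolute summability (`abs_eulerKernel_le`) makes the two results equal. -/

theorem hasSum_conditional_nat_iff {E : Type*} [AddCommMonoid E] [TopologicalSpace E]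
    {f : ℕ → E} {x : E} :
    HasSum f x (SummationFilter.conditional ℕ) ↔
      Tendsto (fun N ↦ ∑ i ∈ Finset.range N, f i) atTop (𝓝 x) := by
  rw [HasSum, SummationFilter.conditional_filter_eq_map_range, tendsto_map'_iff]
  rfl

theorem HasSum.conditional_nat {E : Type*} [AddCommMonoid E] [TopologicalSpace E]
    {f : ℕ → E} {x : E} (h : HasSum f x) : HasSum f x (SummationFilter.conditional ℕ) :=
  hasSum_conditional_nat_iff.2 h.tendsto_sum_nat

theorem tendsto_inv_natCast_add (c : ℝ) :
    Tendsto (fun N : ℕ ↦ ((N : ℝ) + c)⁻¹) atTop (𝓝 0) :=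
  (tendsto_atTop_add_const_right _ c tendsto_natCast_atTop_atTop).inv_tendsto_atTop

theorem tendsto_neg_one_pow_mul_inv_natCast_add (c : ℝ) :
    Tendsto (fun N : ℕ ↦ (-1 : ℝ) ^ N * ((N : ℝ) + c)⁻¹) atTop (𝓝 0) := by
  refine squeeze_zero_norm (fun N ↦ ?_) (by simpa using (tendsto_inv_natCast_add c).norm)
  rw [norm_mul, norm_pow, norm_neg, norm_one, one_pow, one_mul]
  simp

/-- Real Dirichlet beta values at natural arguments, as ordered sums. -/
noncomputable def realBeta (m : ℕ) : ℝ :=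
  ∑'[SummationFilter.conditional ℕ] k : ℕ, (-1 : ℝ) ^ k / (2 * (k : ℝ) + 1) ^ m

theorem hasSum_realBeta {m : ℕ} (hm : 1 ≤ m) :
    HasSum (fun k : ℕ ↦ (-1 : ℝ) ^ k / (2 * (k : ℝ) + 1) ^ m) (realBeta m)
      (SummationFilter.conditional ℕ) := by
  have hanti : Antitone fun k : ℕ ↦ ((2 * (k : ℝ) + 1) ^ m)⁻¹ := by
    intro i j hij
    dsimp only
    gcongr
  have hlim : Tendsto (fun k : ℕ ↦ ((2 * (k : ℝ) + 1) ^ m)⁻¹) atTop (𝓝 0) := by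
    refine Tendsto.inv_tendsto_atTop ?_
    refine (tendsto_pow_atTop (by omega)).comp ?_
    exact tendsto_atTop_add_const_right _ _
      (tendsto_natCast_atTop_atTop.const_mul_atTop zero_lt_two)
  obtain ⟨l, hl⟩ := hanti.tendsto_alternating_series_of_tendsto_zero hlim
  exact Summable.hasSum ⟨l, hasSum_conditional_nat_iff.2 (by simpa only [div_eq_mul_inv] using hl)⟩

/-! ### Limits of harmonic and telescoping sums -/

theorem harmonic_succ_real (k : ℕ) :
    ((harmonic (k + 1) : ℚ) : ℝ) = harmonic k + ((k : ℝ) + 1)⁻¹ := by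
  rw [harmonic_succ]; push_cast; ring

theorem tendsto_harmonic_add_sub (k : ℕ) :
    Tendsto (fun M : ℕ ↦ ((harmonic (M + k) : ℚ) : ℝ) - harmonic M) atTop (𝓝 0) := by
  induction k with
  | zero => simp
  | succ k ih =>
    have h := ih.add (tendsto_inv_natCast_add ((k : ℝ) + 1))
    rw [add_zero] at h
    refine h.congr fun M ↦ ?_
    rw [← add_assoc M, harmonic_succ_real]
    push_cast
    ring

theorem tendsto_harmonic_two_mul_sub :
    Tendsto (fun M : ℕ ↦ ((harmonic (2 * M) : ℚ) : ℝ) - harmonic M) atTop (𝓝 (Real.log 2)) := by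
  have h1 := Real.tendsto_harmonic_sub_log
  have h2 := h1.comp (tendsto_id.const_mul_atTop' (show 0 < 2 by norm_num) : Tendsto (fun M : ℕ ↦ 2 * M) atTop atTop)
  have h3 := (h2.sub h1).add_const (Real.log 2)
  rw [sub_self, zero_add] at h3
  refine h3.congr' ?_
  filter_upwards [eventually_ge_atTop 1] with M hM
  have hM' : (M : ℝ) ≠ 0 := by positivity
  simp only [Function.comp_apply]
  push_cast
  rw [Real.log_mul two_ne_zero hM']
  ring

/-- The partial sum is `2(H_{2M} - H_M) - (H_{M+k} - H_M) + H_k`. -/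
theorem tendsto_sum_two_div_odd_sub_inv (k : ℕ) :
    Tendsto (fun M : ℕ ↦ ∑ m ∈ Finset.range M,
        (2 / (2 * (m : ℝ) + 1) - ((m : ℝ) + k + 1)⁻¹)) atTop
      (𝓝 (harmonic k + 2 * Real.log 2)) := by
  have h := ((tendsto_harmonic_two_mul_sub.const_mul 2).sub (tendsto_harmonic_add_sub k)).add_const
    ((harmonic k : ℚ) : ℝ)
  rw [sub_zero, add_comm] at h
  refine h.congr fun M ↦ ?_
  induction M with
  | zero => simp
  | succ M ih =>
    rw [Finset.sum_range_succ, ← ih, mul_add_one 2 M, ← add_assoc (2 * M) 1 1, add_right_comm M 1 k]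
    simp only [harmonic_succ_real, show 2 * M + 2 = 2 * M + 1 + 1 from rfl]
    push_cast
    have h1 : (2 * (M : ℝ) + 1 + 1)⁻¹ = ((M : ℝ) + 1)⁻¹ / 2 := by
      rw [show 2 * (M : ℝ) + 1 + 1 = (M + 1) * 2 by ring, mul_inv]; ring
    rw [h1]
    ring

/-- With the convention `0⁻¹ = 0`, the singular term is dropped. -/
theorem tendsto_sum_inv_sub_sub_inv_add (k : ℕ) :
    Tendsto (fun M : ℕ ↦ ∑ m ∈ Finset.range M,
        (((m : ℝ) - k)⁻¹ - ((m : ℝ) + k + 1)⁻¹)) atTop (𝓝 0) := by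
  induction k with
  | zero =>
    have h := (tendsto_inv_natCast_add 0).neg
    rw [neg_zero] at h
    refine h.congr fun M ↦ ?_
    have := Finset.sum_range_sub' (fun m : ℕ ↦ (m : ℝ)⁻¹) M
    simpa using this.symm
  | succ k ih =>
    have h := (ih.sub (tendsto_inv_natCast_add (-1 - (k : ℝ)))).sub
      (tendsto_inv_natCast_add ((k : ℝ) + 1))
    simp only [sub_zero] at h
    refine h.congr fun M ↦ ?_
    have h1 := Finset.sum_range_sub' (fun m : ℕ ↦ ((m : ℝ) + (-1 - (k : ℝ)))⁻¹) M
    have h2 := Finset.sum_range_sub' (fun m : ℕ ↦ ((m : ℝ) + ((k : ℝ) + 1))⁻¹) M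
    -- The boundary terms at `m = 0` of the two telescoping sums cancel.
    have h3 : ((-1 - (k : ℝ)))⁻¹ = -((k : ℝ) + 1)⁻¹ := by rw [← inv_neg]; congr 1; ring
    simp only [Nat.cast_zero, zero_add, h3] at h1 h2
    have h4 : ∑ m ∈ Finset.range M, (((m : ℝ) - (k + 1 : ℕ))⁻¹ - ((m : ℝ) + (k + 1 : ℕ) + 1)⁻¹)
        = ∑ m ∈ Finset.range M, (((m : ℝ) - k)⁻¹ - ((m : ℝ) + k + 1)⁻¹)
          + ∑ m ∈ Finset.range M,
            (((m : ℝ) + (-1 - (k : ℝ)))⁻¹ - (((m + 1 : ℕ) : ℝ) + (-1 - (k : ℝ)))⁻¹)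
          + ∑ m ∈ Finset.range M,
            (((m : ℝ) + ((k : ℝ) + 1))⁻¹ - (((m + 1 : ℕ) : ℝ) + ((k : ℝ) + 1))⁻¹) := by
      rw [← Finset.sum_add_distrib, ← Finset.sum_add_distrib]
      refine Finset.sum_congr rfl fun m _ ↦ ?_
      push_cast
      ring_nf
    rw [h4, h1, h2]
    ring

/-- With the convention `0⁻¹ = 0`, the singular term is dropped. -/
theorem tendsto_sum_neg_one_pow_mul_inv_sub_add_inv_add (m : ℕ) :
    Tendsto (fun K : ℕ ↦ ∑ k ∈ Finset.range K,
        (-1 : ℝ) ^ k * (((k : ℝ) - m)⁻¹ + ((k : ℝ) + m + 1)⁻¹)) atTop (𝓝 0) := by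
  induction m with
  | zero =>
    have h := (tendsto_neg_one_pow_mul_inv_natCast_add 0).neg
    rw [neg_zero] at h
    refine h.congr fun K ↦ ?_
    have := Finset.sum_range_sub' (fun k : ℕ ↦ (-1 : ℝ) ^ k * (k : ℝ)⁻¹) K
    simp only [Nat.cast_zero, inv_zero, mul_zero, zero_sub] at this
    rw [add_zero, ← this]
    refine Finset.sum_congr rfl fun k _ ↦ ?_
    push_cast
    ring
  | succ m ih =>
    -- Shifting `k` by one flips the alternating sign, so the sum for `m + 1` is minus the sum for
    -- `m`, up to telescoping terms.
    have h := (ih.neg.sub (tendsto_neg_one_pow_mul_inv_natCast_add (-1 - (m : ℝ)))).sub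
      (tendsto_neg_one_pow_mul_inv_natCast_add ((m : ℝ) + 1))
    simp only [sub_zero, neg_zero] at h
    refine h.congr fun K ↦ ?_
    have h1 := Finset.sum_range_sub' (fun k : ℕ ↦ (-1 : ℝ) ^ k * ((k : ℝ) + (-1 - (m : ℝ)))⁻¹) K
    have h2 := Finset.sum_range_sub' (fun k : ℕ ↦ (-1 : ℝ) ^ k * ((k : ℝ) + ((m : ℝ) + 1))⁻¹) K
    have h3 : ((-1 - (m : ℝ)))⁻¹ = -((m : ℝ) + 1)⁻¹ := by rw [← inv_neg]; congr 1; ring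
    simp only [Nat.cast_zero, zero_add, h3, pow_zero, one_mul] at h1 h2
    have h4 : ∑ k ∈ Finset.range K,
          (-1 : ℝ) ^ k * (((k : ℝ) - (m + 1 : ℕ))⁻¹ + ((k : ℝ) + (m + 1 : ℕ) + 1)⁻¹)
        = -∑ k ∈ Finset.range K, (-1 : ℝ) ^ k * (((k : ℝ) - m)⁻¹ + ((k : ℝ) + m + 1)⁻¹)
          + ∑ k ∈ Finset.range K, ((-1 : ℝ) ^ k * ((k : ℝ) + (-1 - (m : ℝ)))⁻¹
            - (-1 : ℝ) ^ (k + 1) * (((k + 1 : ℕ) : ℝ) + (-1 - (m : ℝ)))⁻¹)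
          + ∑ k ∈ Finset.range K, ((-1 : ℝ) ^ k * ((k : ℝ) + ((m : ℝ) + 1))⁻¹
            - (-1 : ℝ) ^ (k + 1) * (((k + 1 : ℕ) : ℝ) + ((m : ℝ) + 1))⁻¹) := by
      rw [← Finset.sum_neg_distrib, ← Finset.sum_add_distrib, ← Finset.sum_add_distrib]
      refine Finset.sum_congr rfl fun k _ ↦ ?_
      push_cast
      ring_nf
    rw [h4, h1, h2]
    ring

/-! ### The kernel: partial fractions and absolute summability -/

/-- A geometric sum of ratio `(b/a)^2`, with `2b/(b^2-a^2)` and `2a/(b^2-a^2)` split into partial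
fractions. -/
theorem sum_inv_odd_pow_mul_inv_odd_pow {a b : ℝ} (ha : a ≠ 0) (hb : b ≠ 0) (hab : b - a ≠ 0)
    (hab' : b + a ≠ 0) (n : ℕ) :
    ∑ j ∈ Finset.range n, 2 * (1 / a ^ (2 * j + 1) * (1 / b ^ (2 * (n - j) + 1))) =
      (-2 / b + (b - a)⁻¹ + (b + a)⁻¹) / a ^ (2 * n + 1)
        - ((b - a)⁻¹ - (b + a)⁻¹) / b ^ (2 * n + 1) := by
  induction n with
  | zero => simp; field_simp; ring
  | succ n ih =>
    have h : ∑ j ∈ Finset.range n, 2 * (1 / a ^ (2 * j + 1) * (1 / b ^ (2 * (n + 1 - j) + 1)))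
        = (∑ j ∈ Finset.range n, 2 * (1 / a ^ (2 * j + 1) * (1 / b ^ (2 * (n - j) + 1)))) / b ^ 2 := by
      rw [Finset.sum_div]
      refine Finset.sum_congr rfl fun j hj ↦ ?_
      have hj := Finset.mem_range.1 hj
      rw [show 2 * (n + 1 - j) + 1 = 2 * (n - j) + 1 + 2 by omega, pow_add b _ 2]
      field_simp
    rw [Finset.sum_range_succ, h, ih, show 2 * (n + 1 - n) + 1 = 3 by omega,
      show 2 * (n + 1) + 1 = 2 * n + 1 + 2 by ring, pow_add a _ 2, pow_add b _ 2]
    field_simp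
    ring

/-- The absolutely summable kernel of the double series (without signs). The diagonal entry uses
`0⁻¹ = 0`. -/
noncomputable def eulerKernel (n k m : ℕ) : ℝ :=
  (-2 / (2 * (m : ℝ) + 1) + ((m : ℝ) - k)⁻¹ / 2 + ((m : ℝ) + k + 1)⁻¹ / 2)
    / (2 * (k : ℝ) + 1) ^ (2 * n + 1)

theorem eulerKernel_self (n k : ℕ) :
    eulerKernel n k k = -(3 / 2) / (2 * (k : ℝ) + 1) ^ (2 * n + 2) := by
  have h : (2 * (k : ℝ) + 1) ≠ 0 := by positivity
  rw [eulerKernel, sub_self, inv_zero, show (k : ℝ) + k + 1 = 2 * k + 1 by ring,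
    show 2 * n + 2 = 2 * n + 1 + 1 by ring, pow_succ _ (2 * n + 1)]
  field_simp
  ring

/-- On the diagonal the `n` products contribute `2n`, and the dropped singular terms leave `1` more:
hence the factor `2n+1`. -/
theorem eulerKernel_eq_sum (n k m : ℕ) :
    eulerKernel n k m =
      ∑ j ∈ Finset.range n, 2 * (1 / (2 * (k : ℝ) + 1) ^ (2 * j + 1) *
        (1 / (2 * (m : ℝ) + 1) ^ (2 * (n - j) + 1)))
      - (((k : ℝ) - m)⁻¹ + ((k : ℝ) + m + 1)⁻¹) / 2 / (2 * (m : ℝ) + 1) ^ (2 * n + 1)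
      - if k = m then (2 * (n : ℝ) + 1) / (2 * (m : ℝ) + 1) ^ (2 * n + 2) else 0 := by
  have ha : (2 * (k : ℝ) + 1) ≠ 0 := by positivity
  have hb : (2 * (m : ℝ) + 1) ≠ 0 := by positivity
  have hab : (2 * (m : ℝ) + 1) + (2 * (k : ℝ) + 1) ≠ 0 := by positivity
  split_ifs with h
  · subst h
    have hs : ∑ j ∈ Finset.range n, 2 * (1 / (2 * (k : ℝ) + 1) ^ (2 * j + 1) *
        (1 / (2 * (k : ℝ) + 1) ^ (2 * (n - j) + 1)))
        = ∑ j ∈ Finset.range n, 2 / (2 * (k : ℝ) + 1) ^ (2 * n + 2) := by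
      refine Finset.sum_congr rfl fun j hj ↦ ?_
      have hj := Finset.mem_range.1 hj
      rw [one_div_mul_one_div, ← pow_add, mul_one_div]
      congr 2
      omega
    rw [hs, eulerKernel_self, Finset.sum_const, Finset.card_range, nsmul_eq_mul, sub_self, inv_zero,
      show (k : ℝ) + k + 1 = 2 * k + 1 by ring, show 2 * n + 2 = 2 * n + 1 + 1 by ring,
      pow_succ _ (2 * n + 1)]
    field_simp
    ring
  · have hmk : (m : ℝ) - k ≠ 0 := sub_ne_zero.2 fun e ↦ h (by exact_mod_cast e.symm)
    have h1 : (2 * (m : ℝ) + 1) - (2 * (k : ℝ) + 1) = ((m : ℝ) - k) * 2 := by ring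
    have h2 : (2 * (m : ℝ) + 1) + (2 * (k : ℝ) + 1) = ((m : ℝ) + k + 1) * 2 := by ring
    rw [sum_inv_odd_pow_mul_inv_odd_pow ha hb (by rw [h1]; positivity) hab, h1, h2, mul_inv,
      mul_inv, ← neg_sub (m : ℝ) k, inv_neg, add_comm (k : ℝ) m, eulerKernel]
    ring

theorem abs_eulerKernel_le {n : ℕ} (hn : 1 ≤ n) (k m : ℕ) :
    |eulerKernel n k m| ≤ 2 * (1 / ((2 * (k : ℝ) + 1) * √(2 * (k : ℝ) + 1)) *
      (1 / ((2 * (m : ℝ) + 1) * √(2 * (m : ℝ) + 1)))) := by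
  set a : ℝ := 2 * (k : ℝ) + 1 with ha
  set b : ℝ := 2 * (m : ℝ) + 1 with hb
  have ha1 : 1 ≤ a := by rw [ha]; linarith [(Nat.cast_nonneg k : (0 : ℝ) ≤ k)]
  have hb1 : 1 ≤ b := by rw [hb]; linarith [(Nat.cast_nonneg m : (0 : ℝ) ≤ m)]
  have ha0 : 0 < a := by linarith
  have hb0 : 0 < b := by linarith
  have hsa : 0 < √a := Real.sqrt_pos.2 ha0
  have hsb : 0 < √b := Real.sqrt_pos.2 hb0
  have hqa : √a * √a = a := Real.mul_self_sqrt ha0.le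
  have hqb : √b * √b = b := Real.mul_self_sqrt hb0.le
  have hpow : a ^ 3 ≤ a ^ (2 * n + 1) := pow_le_pow_right₀ ha1 (by omega)
  by_cases h : k = m
  · subst h
    rw [eulerKernel_self, ← ha, abs_div, abs_of_pos (pow_pos ha0 _), abs_neg,
      abs_of_pos (by norm_num : (0 : ℝ) < 3 / 2)]
    have h3 : 1 / (a * √a) * (1 / (a * √a)) = 1 / a ^ 3 := by
      rw [div_mul_div_comm, one_mul, mul_mul_mul_comm, hqa]; ring
    rw [show b = a from rfl, h3, ← mul_one_div (3 / 2)]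
    have : 1 / a ^ (2 * n + 2) ≤ 1 / a ^ 3 :=
      one_div_le_one_div_of_le (by positivity) (pow_le_pow_right₀ ha1 (by omega))
    have : 0 < 1 / a ^ 3 := by positivity
    linarith
  · have hmk : (m : ℝ) - k ≠ 0 := sub_ne_zero.2 fun e ↦ h (by exact_mod_cast e.symm)
    have habs : 1 ≤ |(m : ℝ) - k| := by
      have : (1 : ℤ) ≤ |(m : ℤ) - k| := Int.one_le_abs (by omega)
      exact_mod_cast this
    -- The three fractions combine with a numerator `a^2`; this cancellation gives the decay in `b`.
    have hE : eulerKernel n k m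
        = a ^ 2 / (b * (((m : ℝ) - k) * (a + b))) / a ^ (2 * n + 1) := by
      have h2 : (m : ℝ) + k + 1 = (a + b) / 2 := by rw [ha, hb]; ring
      have hk : (k : ℝ) = (a - 1) / 2 := by rw [ha]; ring
      have hm : (m : ℝ) = (b - 1) / 2 := by rw [hb]; ring
      have hab : a + b ≠ 0 := by positivity
      rw [eulerKernel, ← ha, ← hb, h2]
      have h1 : (m : ℝ) - k = (b - a) / 2 := by rw [hk, hm]; ring
      have h4 : b - a ≠ 0 := fun e ↦ hmk (by rw [h1, e, zero_div])
      rw [h1]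
      congr 1
      field_simp
      ring
    rw [hE, abs_div, abs_div, abs_mul, abs_mul, abs_of_pos (pow_pos ha0 _),
      abs_of_pos (pow_pos ha0 _), abs_of_pos hb0, abs_of_pos (by linarith : 0 < a + b)]
    have hs : √a * √b ≤ a + b := by nlinarith [sq_nonneg (√a - √b)]
    calc a ^ 2 / (b * (|(m : ℝ) - k| * (a + b))) / a ^ (2 * n + 1)
        ≤ a ^ 2 / (b * (1 * (√a * √b))) / a ^ 3 := by gcongr
      _ = 1 / (a * √a) * (1 / (b * √b)) := by field_simp
      _ ≤ _ := by
        have : 0 < 1 / (a * √a) * (1 / (b * √b)) := by positivity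
        linarith

theorem summable_one_div_odd_mul_sqrt :
    Summable fun k : ℕ ↦ 1 / ((2 * (k : ℝ) + 1) * √(2 * (k : ℝ) + 1)) := by
  refine Summable.of_nonneg_of_le (fun k ↦ by positivity) (fun k ↦ ?_)
    ((Real.summable_one_div_nat_add_rpow 1 (3 / 2)).2 (by norm_num))
  have h0 : (0 : ℝ) < k + 1 := by positivity
  rw [abs_of_pos h0, show (3 / 2 : ℝ) = 1 + 1 / 2 by norm_num, Real.rpow_add h0, Real.rpow_one,
    ← Real.sqrt_eq_rpow]
  have : (k : ℝ) + 1 ≤ 2 * k + 1 := by linarith [(Nat.cast_nonneg k : (0 : ℝ) ≤ k)]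
  gcongr

theorem summable_neg_one_pow_mul_eulerKernel {n : ℕ} (hn : 1 ≤ n) :
    Summable fun p : ℕ × ℕ ↦ (-1 : ℝ) ^ p.1 * eulerKernel n p.1 p.2 := by
  refine Summable.of_norm_bounded ((summable_one_div_odd_mul_sqrt.mul_of_nonneg
    summable_one_div_odd_mul_sqrt (fun _ ↦ by positivity) (fun _ ↦ by positivity)).mul_left 2)
    fun p ↦ ?_
  rw [norm_mul, norm_pow, norm_neg, norm_one, one_pow, one_mul]
  exact abs_eulerKernel_le hn p.1 p.2

/-! ### The two iterated sums and their comparison -/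

theorem hasSum_eulerKernel_right (n k : ℕ) :
    HasSum (fun m : ℕ ↦ (-1 : ℝ) ^ k * eulerKernel n k m)
      (-((-1) ^ k * (harmonic k + 2 * Real.log 2) / (2 * (k : ℝ) + 1) ^ (2 * n + 1)))
      (SummationFilter.conditional ℕ) := by
  have h1 := hasSum_conditional_nat_iff.2 (tendsto_sum_two_div_odd_sub_inv k)
  have h2 := hasSum_conditional_nat_iff.2 (tendsto_sum_inv_sub_sub_inv_add k)
  have h := (h1.neg.add (h2.mul_left (1 / 2))).mul_left ((-1) ^ k / (2 * (k : ℝ) + 1) ^ (2 * n + 1))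
  convert! h using 1
  · ext m
    rw [eulerKernel]
    ring
  · ring

theorem hasSum_eulerKernel_left (n m : ℕ) :
    HasSum (fun k : ℕ ↦ (-1 : ℝ) ^ k * eulerKernel n k m)
      (∑ j ∈ Finset.range n, 2 * realBeta (2 * j + 1) * (1 / (2 * (m : ℝ) + 1) ^ (2 * (n - j) + 1))
        - (2 * (n : ℝ) + 1) * ((-1) ^ m / (2 * (m : ℝ) + 1) ^ (2 * n + 2)))
      (SummationFilter.conditional ℕ) := by
  have h1 : HasSum (fun k : ℕ ↦ ∑ j ∈ Finset.range n,
      (-1 : ℝ) ^ k / (2 * (k : ℝ) + 1) ^ (2 * j + 1) *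
        (2 * (1 / (2 * (m : ℝ) + 1) ^ (2 * (n - j) + 1)))) _ (SummationFilter.conditional ℕ) :=
    hasSum_sum fun j _ ↦ (hasSum_realBeta (m := 2 * j + 1) (by omega)).mul_right _
  have h2 := (hasSum_conditional_nat_iff.2
    (tendsto_sum_neg_one_pow_mul_inv_sub_add_inv_add m)).mul_right
      (1 / 2 / (2 * (m : ℝ) + 1) ^ (2 * n + 1))
  have h3 := (hasSum_ite_eq m
    ((2 * (n : ℝ) + 1) * ((-1) ^ m / (2 * (m : ℝ) + 1) ^ (2 * n + 2)))).conditional_nat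
  convert! (h1.sub h2).sub h3 using 1
  · ext k
    rw [eulerKernel_eq_sum, mul_sub, mul_sub, Finset.mul_sum]
    congr 1
    · congr 1
      · exact Finset.sum_congr rfl fun j _ ↦ by ring
      · ring
    · split_ifs with h
      · rw [h]; ring
      · ring
  · rw [zero_mul, sub_zero]
    congr 1
    exact Finset.sum_congr rfl fun j _ ↦ by ring

/-- Sums of reciprocal powers of the odd numbers. -/
theorem hasSum_one_div_odd_pow {s : ℕ} (hs : 1 < s) :
    HasSum (fun m : ℕ ↦ 1 / (2 * (m : ℂ) + 1) ^ s) ((1 - 1 / 2 ^ s) * riemannZeta s) := by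
  have hz : HasSum (fun m : ℕ ↦ 1 / (m : ℂ) ^ s) (riemannZeta s) := by
    rw [zeta_nat_eq_tsum_of_gt_one hs]
    have h := Complex.summable_ofReal.2 (Real.summable_one_div_nat_pow.2 hs)
    push_cast at h
    exact h.hasSum
  have he : HasSum (fun m : ℕ ↦ 1 / ((2 * m : ℕ) : ℂ) ^ s) (1 / 2 ^ s * riemannZeta s) := by
    convert! hz.mul_left (1 / 2 ^ s) using 1
    ext m
    push_cast
    rw [mul_pow]
    ring
  have ho : Summable fun m : ℕ ↦ 1 / ((2 * m + 1 : ℕ) : ℂ) ^ s :=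
    hz.summable.comp_injective (i := fun m : ℕ ↦ 2 * m + 1) fun _ _ h ↦ by simpa using h
  have hu := (HasSum.even_add_odd (f := fun m : ℕ ↦ 1 / (m : ℂ) ^ s) he ho.hasSum).unique hz
  convert! ho.hasSum using 1
  · ext m; push_cast; rfl
  · rw [sub_mul, one_mul, sub_eq_iff_eq_add', hu]

/-- `λ(s) = ∑ 1 / (2m+1)^s`, as a real number. -/
noncomputable def realLambda (s : ℕ) : ℝ := ∑' m : ℕ, 1 / (2 * (m : ℝ) + 1) ^ s

theorem hasSum_realLambda {s : ℕ} (hs : 1 < s) :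
    HasSum (fun m : ℕ ↦ 1 / (2 * (m : ℝ) + 1) ^ s) (realLambda s) := by
  refine Summable.hasSum ?_
  rw [← Complex.summable_ofReal]
  push_cast
  exact (hasSum_one_div_odd_pow hs).summable

theorem ofReal_realLambda {s : ℕ} (hs : 1 < s) :
    (realLambda s : ℂ) = (1 - 1 / 2 ^ s) * riemannZeta s := by
  refine HasSum.unique ?_ (hasSum_one_div_odd_pow hs)
  have h := Complex.hasSum_ofReal.2 (hasSum_realLambda hs)
  push_cast at h
  exact h

theorem hasSum_harmonic_beta {n : ℕ} (hn : 1 ≤ n) :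
    HasSum (fun k : ℕ ↦ (-1 : ℝ) ^ k * (harmonic k : ℚ) / (2 * (k : ℝ) + 1) ^ (2 * n + 1))
      ((2 * (n : ℝ) + 1) * realBeta (2 * n + 2) - realBeta (2 * n + 1) * Real.log 4
        - 2 * ∑ j ∈ Finset.range n, realLambda (2 * (n - j) + 1) * realBeta (2 * j + 1))
      (SummationFilter.conditional ℕ) := by
  have hP := summable_neg_one_pow_mul_eulerKernel hn
  have hrow : ∀ k, HasSum (fun m : ℕ ↦ (-1 : ℝ) ^ k * eulerKernel n k m)
      (-((-1) ^ k * (harmonic k + 2 * Real.log 2) / (2 * (k : ℝ) + 1) ^ (2 * n + 1))) := by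
    intro k
    have h := (hP.prod_factor k).hasSum
    -- Absolute summability supplies an unconditional sum; the ordered sum only identifies its
    -- value. The separate pieces, such as the series for `β(1)`, need not converge absolutely.
    rwa [h.conditional_nat.unique (hasSum_eulerKernel_right n k)] at h
  have hcol : ∀ m, HasSum (fun k : ℕ ↦ (-1 : ℝ) ^ k * eulerKernel n k m)
      (∑ j ∈ Finset.range n, 2 * realBeta (2 * j + 1) * (1 / (2 * (m : ℝ) + 1) ^ (2 * (n - j) + 1))
        - (2 * (n : ℝ) + 1) * ((-1) ^ m / (2 * (m : ℝ) + 1) ^ (2 * n + 2))) := by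
    intro m
    have h := (hP.prod_symm.prod_factor m).hasSum
    rw [h.conditional_nat.unique (hasSum_eulerKernel_left n m)] at h
    exact h
  have h1 := (hP.hasSum.prod_fiberwise hrow).conditional_nat
  have h2 := (hP.prod_symm.hasSum.prod_fiberwise hcol).conditional_nat
  have h3 : HasSum (fun m : ℕ ↦ ∑ j ∈ Finset.range n,
      2 * realBeta (2 * j + 1) * (1 / (2 * (m : ℝ) + 1) ^ (2 * (n - j) + 1))) _
      (SummationFilter.conditional ℕ) := hasSum_sum fun j hj ↦
    ((hasSum_realLambda (s := 2 * (n - j) + 1)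
      (by have := Finset.mem_range.1 hj; omega)).conditional_nat).mul_left _
  have h4 := h3.sub ((hasSum_realBeta (m := 2 * n + 2) (by omega)).mul_left (2 * (n : ℝ) + 1))
  have hval := h2.unique h4
  have hswap : ∑' p : ℕ × ℕ, (-1 : ℝ) ^ p.swap.1 * eulerKernel n p.swap.1 p.swap.2
      = ∑' p : ℕ × ℕ, (-1 : ℝ) ^ p.1 * eulerKernel n p.1 p.2 :=
    (Equiv.prodComm ℕ ℕ).tsum_eq fun p : ℕ × ℕ ↦ (-1 : ℝ) ^ p.1 * eulerKernel n p.1 p.2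
  rw [hswap] at hval
  rw [hval] at h1
  have h5 := h1.neg.sub ((hasSum_realBeta (m := 2 * n + 1) (by omega)).mul_right (2 * Real.log 2))
  convert! h5 using 1
  · ext k; ring
  · rw [show (4 : ℝ) = 2 ^ 2 by norm_num, Real.log_pow, Finset.mul_sum, neg_sub, sub_right_comm]
    congr 1
    · congr 1
      exact Finset.sum_congr rfl fun j _ ↦ by ring

/-! ### Transfer to the complex series -/

theorem betaTerm_natCast (m k : ℕ) :
    betaTerm m k = (((-1 : ℝ) ^ k / (2 * (k : ℝ) + 1) ^ m : ℝ) : ℂ) := by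
  rw [betaTerm, Complex.cpow_natCast]; push_cast; rfl

theorem betaHTerm_natCast (m k : ℕ) :
    betaHTerm m k = (((-1 : ℝ) ^ k * (harmonic k : ℚ) / (2 * (k : ℝ) + 1) ^ m : ℝ) : ℂ) := by
  rw [betaHTerm, Complex.cpow_natCast]; push_cast; rfl

theorem HasSum.complex_ofReal {ι : Type*} {L : SummationFilter ι} {f : ι → ℝ} {x : ℝ}
    (h : HasSum f x L) : HasSum (fun i ↦ (f i : ℂ)) x L :=
  h.map Complex.ofRealHom Complex.continuous_ofReal

theorem hasSum_betaTerm {m : ℕ} (hm : 1 ≤ m) :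
    HasSum (betaTerm m) (realBeta m) (SummationFilter.conditional ℕ) := by
  rw [funext (betaTerm_natCast m)]
  exact (hasSum_realBeta hm).complex_ofReal

theorem dirichletBeta_natCast {m : ℕ} (hm : 1 ≤ m) : dirichletBeta m = realBeta m :=
  (hasSum_betaTerm hm).tsum_eq

theorem mainTheorem9 (n : ℕ) (hn : 1 ≤ n) :
    (∀ m : ℕ, 1 ≤ m → Summable (betaTerm (m : ℂ)) (SummationFilter.conditional ℕ)) ∧
    Summable (betaHTerm (2 * (n : ℂ) + 1)) (SummationFilter.conditional ℕ) ∧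
    dirichletBetaH (2 * (n : ℂ) + 1) =
      (2 * (n : ℂ) + 1) * dirichletBeta (2 * (n : ℂ) + 2)
        - dirichletBeta (2 * (n : ℂ) + 1) * (Real.log 4 : ℂ)
        - 2 * ∑ j ∈ Finset.range n,
            (1 - 1 / (2 : ℂ) ^ (2 * (n : ℤ) - 2 * (j : ℤ) + 1)) *
              dirichletBeta (2 * (j : ℂ) + 1) *
              riemannZeta (2 * (n : ℂ) - 2 * (j : ℂ) + 1) := by
  have c1 (j : ℕ) : 2 * (j : ℂ) + 1 = ((2 * j + 1 : ℕ) : ℂ) := by push_cast; ring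
  have c2 : 2 * (n : ℂ) + 2 = ((2 * n + 2 : ℕ) : ℂ) := by push_cast; ring
  have hH := (hasSum_harmonic_beta hn).complex_ofReal
  rw [← funext (betaHTerm_natCast (2 * n + 1)), ← c1] at hH
  refine ⟨fun m hm ↦ (hasSum_betaTerm hm).summable, hH.summable, ?_⟩
  have hsum : ∑ j ∈ Finset.range n,
      (1 - 1 / (2 : ℂ) ^ (2 * (n : ℤ) - 2 * (j : ℤ) + 1)) * dirichletBeta (2 * (j : ℂ) + 1) *
        riemannZeta (2 * (n : ℂ) - 2 * (j : ℂ) + 1)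
      = ∑ j ∈ Finset.range n, (realLambda (2 * (n - j) + 1) : ℂ) * realBeta (2 * j + 1) := by
    refine Finset.sum_congr rfl fun j hj ↦ ?_
    have hj := Finset.mem_range.1 hj
    have e1 : 2 * (n : ℤ) - 2 * (j : ℤ) + 1 = ((2 * (n - j) + 1 : ℕ) : ℤ) := by omega
    have e2 : 2 * (n : ℂ) - 2 * (j : ℂ) + 1 = ((2 * (n - j) + 1 : ℕ) : ℂ) := by
      push_cast [Nat.cast_sub hj.le]; ring
    rw [c1, dirichletBeta_natCast (by omega), e1, e2, zpow_natCast, ofReal_realLambda (by omega)]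
    ring
  rw [hsum, dirichletBetaH, hH.tsum_eq, c2, dirichletBeta_natCast (by omega), c1 n,
    dirichletBeta_natCast (by omega)]
  push_cast
  ring
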